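/- Let $q$ be a formal variable, and for even $k\ge 2$ let $$E_k = 1-\frac{2k}{B_k}\sum_{n\ge 1}\sigma_{k-1}(n)\,q^n,\qquad \sigma_{m}(n)=\sum_{d\mid n}d^{m},\qquad \frac{t}{e^t-1}=\sum_{k\ge 0}B_k\frac{t^k}{k!},$$ be the $q$-expansion of the normalised Eisenstein series of weight $k$. Let $\Theta = q\,\frac{d}{dq}$, so that $\Theta\left(\sum a(n)q^n\right)=\sum n\,a(n)q^n$. For a prime $\ell$ let $\mathbb{Z}_{(\ell)}=\{a/b\in\mathbb{Q}:\ell\nmid b\}$; a series $\sum a(n)q^n$ is $\equiv 0 \bmod \ell$ if $a(n)\in\ell\,\mathbb{Z}_{(\ell)}$ for every $n$. Let $f=E_2^{\,r}E_4^{\,s}E_6^{\,t}$, where $r\ge 0$ and $s,t$ are integers. If $\ell$ is a prime such that $\Theta f\equiv 0 \bmod \ell$, then either $\ell\le 13$ or $r\equiv s\equiv t\equiv 0 \bmod \ell$. -/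

import Mathlib

open scoped LaurentSeries

noncomputable section

/-- The `q`-expansion `E_k = 1 - (2k / B_k) ∑_{n ≥ 1} σ_{k-1}(n) q^n` of the normalised Eisenstein
series of (even) weight `k ≥ 2`, as a formal power series with rational coefficients. -/
def eisensteinPowerSeries (k : ℕ) : PowerSeries ℚ :=
  PowerSeries.mk fun n =>
    if n = 0 then 1
    else -(2 * (k : ℚ) / bernoulli k) * (ArithmeticFunction.sigma (k - 1) n : ℚ)

/-- The Eisenstein series `E_k` in the field of formal Laurent series in `q` over `ℚ`. -/
def eisensteinQ (k : ℕ) : ℚ⸨X⸩ :=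
  HahnSeries.ofPowerSeries ℤ ℚ (eisensteinPowerSeries k)

/-- Ramanujan's operator `Θ = q d/dq` on formal Laurent series in `q`. -/
def ramanujanTheta (f : ℚ⸨X⸩) : ℚ⸨X⸩ :=
  HahnSeries.single 1 1 * LaurentSeries.derivative ℚ f

/-- `Θ (∑ a(n) q^n) = ∑ n a(n) q^n`. -/
theorem ramanujanTheta_coeff (f : ℚ⸨X⸩) (n : ℤ) :
    (ramanujanTheta f).coeff n = (n : ℚ) * f.coeff n := by
  have h := HahnSeries.coeff_single_mul_add (r := (1 : ℚ)) (x := LaurentSeries.derivative ℚ f)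
    (a := n - 1) (b := (1 : ℤ))
  rw [sub_add_cancel] at h
  rw [ramanujanTheta, h]
  simp [LaurentSeries.derivative_apply, LaurentSeries.hasseDeriv_coeff]

/-- The local ring `ℤ_(ℓ) = {a / b : ℓ ∤ b}` as a set of rational numbers. -/
def localIntegers (ℓ : ℕ) : Set ℚ :=
  {x | ∃ a b : ℤ, ¬ (ℓ : ℤ) ∣ b ∧ x = (a : ℚ) / (b : ℚ)}

/-- Congruence modulo `ℓ` of Laurent series: each coefficient of `f - g` lies in `ℓ ℤ_(ℓ)`. -/
def CongrMod (ℓ : ℕ) (f g : ℚ⸨X⸩) : Prop :=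
  ∀ n : ℤ, ∃ z ∈ localIntegers ℓ, (f - g).coeff n = (ℓ : ℚ) * z

end

/-! Since `-2k/B_k` is `-24`, `240`, `-504` for `k = 2, 4, 6`, each factor of `f` is a unit of
`ℤ⟦q⟧`, hence so is `f`, even for negative exponents. If `Θ f ≡ 0`, then `ℓ` divides `f'`, and
therefore `f'/f = r E₂'/E₂ + s E₄'/E₄ + t E₆'/E₆`. Its first three coefficients form a linear system
in `r, s, t` whose determinant is, up to sign, `2^18 * 3^8 * 5^2 * 7^2 * 11 * 13`. For `ℓ > 13` it
is invertible mod `ℓ`, which forces `r, s, t ≡ 0`. -/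

open PowerSeries in
/-- A power series over `ℤ` with constant coefficient `1`, as a unit. -/
noncomputable def unitOfConstantCoeffOne (a : PowerSeries ℤ) (ha : constantCoeff a = 1) : (PowerSeries ℤ)ˣ :=
  (PowerSeries.isUnit_iff_constantCoeff.mpr (by rw [ha]; exact isUnit_one) : IsUnit a).unit

/-- The series `1 + c ∑_{n ≥ 1} σ_m(n) q^n` with integer coefficients. -/
noncomputable def sigmaSeries (c : ℤ) (m : ℕ) : PowerSeries ℤ :=
  PowerSeries.mk fun n => if n = 0 then 1 else c * (ArithmeticFunction.sigma m n : ℤ)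

/-- `sigmaSeries c m` as a unit of `ℤ⟦q⟧`. -/
noncomputable def sigmaUnit (c : ℤ) (m : ℕ) : (PowerSeries ℤ)ˣ :=
  unitOfConstantCoeffOne (sigmaSeries c m) (by
    simp [sigmaSeries, ← PowerSeries.coeff_zero_eq_constantCoeff_apply])

@[simp]
theorem val_sigmaUnit (c : ℤ) (m : ℕ) : (sigmaUnit c m : PowerSeries ℤ) = sigmaSeries c m := rfl

/-- The embedding of `ℤ⟦q⟧` in the field of Laurent series over `ℚ`. -/
noncomputable def intSeriesToLaurent : PowerSeries ℤ →+* ℚ⸨X⸩ :=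
  (HahnSeries.ofPowerSeries ℤ ℚ).comp (PowerSeries.map (Int.castRingHom ℚ))

theorem intSeriesToLaurent_coeff (a : PowerSeries ℤ) (n : ℕ) :
    (intSeriesToLaurent a).coeff (n : ℤ) = ((PowerSeries.coeff n a : ℤ) : ℚ) := by
  simp [intSeriesToLaurent]

theorem intSeriesToLaurent_sigmaSeries (k : ℕ) (c : ℤ) (hc : -(2 * (k : ℚ) / bernoulli k) = c) :
    intSeriesToLaurent (sigmaSeries c (k - 1)) = eisensteinQ k := by
  rw [intSeriesToLaurent, RingHom.comp_apply, eisensteinQ]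
  congr 1
  ext n
  simp only [sigmaSeries, eisensteinPowerSeries, PowerSeries.coeff_map, PowerSeries.coeff_mk, hc]
  split_ifs <;> simp

theorem bernoulli_four : bernoulli 4 = -1 / 30 := by
  rw [bernoulli_eq_bernoulli'_of_ne_one (by norm_num), bernoulli'_four]

theorem bernoulli_six : bernoulli 6 = 1 / 42 := by
  have h5 : bernoulli' 5 = 0 := bernoulli'_eq_zero_of_odd (by decide) (by norm_num)
  have c2 : Nat.choose 6 2 = 15 := by decide
  have c3 : Nat.choose 6 3 = 20 := by decide
  have c4 : Nat.choose 6 4 = 15 := by decide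
  rw [bernoulli_eq_bernoulli'_of_ne_one (by norm_num), bernoulli'_def]
  norm_num [Finset.sum_range_succ, h5, c2, c3, c4]

theorem eisensteinQ_two : eisensteinQ 2 = intSeriesToLaurent (sigmaUnit (-24) 1) := by
  rw [val_sigmaUnit, ← intSeriesToLaurent_sigmaSeries 2 (-24) (by rw [bernoulli_two]; norm_num)]

theorem eisensteinQ_four : eisensteinQ 4 = intSeriesToLaurent (sigmaUnit 240 3) := by
  rw [val_sigmaUnit, ← intSeriesToLaurent_sigmaSeries 4 240 (by rw [bernoulli_four]; norm_num)]

theorem eisensteinQ_six : eisensteinQ 6 = intSeriesToLaurent (sigmaUnit (-504) 5) := by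
  rw [val_sigmaUnit, ← intSeriesToLaurent_sigmaSeries 6 (-504) (by rw [bernoulli_six]; norm_num)]

/-- Matches negative powers taken among the units of `ℤ⟦q⟧` with those taken in the Laurent series
field. -/
theorem map_units_zpow {A K : Type*} [Monoid A] [DivisionRing K] (φ : A →* K) (u : Aˣ) (n : ℤ) :
    φ ((u ^ n : Aˣ) : A) = φ u ^ n := by
  have h := congrArg Units.val (map_zpow (Units.map φ) u n)
  rwa [Units.val_zpow_eq_zpow_val] at h

/-- The logarithmic derivative `u ↦ u' / u` on the units of `ℤ⟦q⟧`. -/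
noncomputable def unitLogDeriv : (PowerSeries ℤ)ˣ →* Multiplicative (PowerSeries ℤ) where
  toFun u := Multiplicative.ofAdd
    ((u⁻¹ : (PowerSeries ℤ)ˣ) * PowerSeries.derivative ℤ (u : PowerSeries ℤ))
  map_one' := by simp
  map_mul' u v := by
    rw [← ofAdd_add]
    congr 1
    have hu := u.inv_mul
    have hv := v.inv_mul
    simp only [mul_inv, Units.val_mul, Derivation.leibniz, smul_eq_mul]
    linear_combination (v⁻¹ : (PowerSeries ℤ)ˣ) * PowerSeries.derivative ℤ (v : PowerSeries ℤ) * hu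
      + (u⁻¹ : (PowerSeries ℤ)ˣ) * PowerSeries.derivative ℤ (u : PowerSeries ℤ) * hv

theorem mul_unitLogDeriv (u : (PowerSeries ℤ)ˣ) :
    (u : PowerSeries ℤ) * (unitLogDeriv u).toAdd = PowerSeries.derivative ℤ (u : PowerSeries ℤ) := by
  simp [unitLogDeriv]

theorem dvd_of_eq_mul_localIntegers {ℓ : ℕ} (hℓ : ℓ.Prime) {m : ℤ} {z : ℚ}
    (hz : z ∈ localIntegers ℓ) (h : (m : ℚ) = ℓ * z) : (ℓ : ℤ) ∣ m := by
  obtain ⟨a, b, hb, rfl⟩ := hz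
  have hb0 : (b : ℚ) ≠ 0 := by
    rintro h0
    exact hb (by rw [Int.cast_eq_zero.mp h0]; exact dvd_zero _)
  have h' : m * b = ℓ * a := by
    field_simp at h
    exact_mod_cast h
  exact ((Nat.prime_iff_prime_int.mp hℓ).dvd_or_dvd ⟨a, h'⟩).resolve_right hb

theorem dvd_coeff_unitLogDeriv {ℓ : ℕ} (hℓ : ℓ.Prime) (u : (PowerSeries ℤ)ˣ)
    (h : CongrMod ℓ (ramanujanTheta (intSeriesToLaurent u)) 0) (n : ℕ) :
    (ℓ : ℤ) ∣ PowerSeries.coeff n (unitLogDeriv u).toAdd := by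
  have hd (k : ℕ) : (ℓ : ℤ) ∣
      PowerSeries.coeff k (PowerSeries.derivative ℤ (u : PowerSeries ℤ)) := by
    -- `Θ f = q f'`, so coefficient `k` of `f'` is coefficient `k + 1` of `Θ f`.
    obtain ⟨z, hz, hk⟩ := h ((k + 1 : ℕ) : ℤ)
    refine dvd_of_eq_mul_localIntegers hℓ hz ?_
    rw [← hk, sub_zero, ramanujanTheta_coeff, intSeriesToLaurent_coeff,
      PowerSeries.coeff_derivative]
    push_cast
    ring
  change (ℓ : ℤ) ∣ PowerSeries.coeff n (((u⁻¹ : (PowerSeries ℤ)ˣ) : PowerSeries ℤ) * _)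
  rw [PowerSeries.coeff_mul]
  exact Finset.dvd_sum fun p _ => (hd p.2).mul_left _

/-- The first coefficients of the logarithmic derivative of `1 + a₁ q + a₂ q² + a₃ q³ + ⋯`. -/
theorem coeff_unitLogDeriv_sigmaUnit (c : ℤ) (m : ℕ) {s₂ s₃ : ℤ}
    (h₂ : (ArithmeticFunction.sigma m 2 : ℤ) = s₂) (h₃ : (ArithmeticFunction.sigma m 3 : ℤ) = s₃) :
    PowerSeries.coeff 0 (unitLogDeriv (sigmaUnit c m)).toAdd = c ∧
    PowerSeries.coeff 1 (unitLogDeriv (sigmaUnit c m)).toAdd = 2 * (c * s₂) - c * c ∧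
    PowerSeries.coeff 2 (unitLogDeriv (sigmaUnit c m)).toAdd =
      3 * (c * s₃) - c * (2 * (c * s₂) - c * c) - c * s₂ * c := by
  -- Comparing coefficients in `u * L = u'` determines `L` recursively, because `u` has constant
  -- term `1`.
  have h := mul_unitLogDeriv (sigmaUnit c m)
  set L := (unitLogDeriv (sigmaUnit c m)).toAdd
  have e0 := congrArg (PowerSeries.coeff 0) h
  have e1 := congrArg (PowerSeries.coeff 1) h
  have e2 := congrArg (PowerSeries.coeff 2) h
  simp only [PowerSeries.coeff_mul, PowerSeries.coeff_derivative, val_sigmaUnit, sigmaSeries,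
    PowerSeries.coeff_mk, Finset.Nat.sum_antidiagonal_eq_sum_range_succ_mk,
    Finset.sum_range_succ, Finset.sum_range_zero] at e0 e1 e2
  norm_num [h₂, h₃] at e0 e1 e2
  rw [e0] at e1 e2
  have e1' : PowerSeries.coeff 1 L = 2 * (c * s₂) - c * c := by linarith
  rw [e1'] at e2
  exact ⟨by simpa using e0, e1', by linarith⟩

theorem le_thirteen_of_dvd {ℓ : ℕ} (hℓ : ℓ.Prime)
    (h : (ℓ : ℤ) ∣ 2 ^ 18 * 3 ^ 8 * 5 ^ 2 * 7 ^ 2 * 11 * 13) : ℓ ≤ 13 := by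
  have hp := Nat.prime_iff_prime_int.mp hℓ
  have key (p : ℕ) (hp13 : p ≤ 13) (hp0 : 0 < p) (hd : (ℓ : ℤ) ∣ p) : ℓ ≤ 13 :=
    (Nat.le_of_dvd hp0 (Int.natCast_dvd_natCast.mp hd)).trans hp13
  simp only [hp.dvd_mul] at h
  rcases h with ((((h | h) | h) | h) | h) | h
  · exact key 2 (by norm_num) (by norm_num) (hp.dvd_of_dvd_pow h)
  · exact key 3 (by norm_num) (by norm_num) (hp.dvd_of_dvd_pow h)
  · exact key 5 (by norm_num) (by norm_num) (hp.dvd_of_dvd_pow h)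
  · exact key 7 (by norm_num) (by norm_num) (hp.dvd_of_dvd_pow h)
  · exact key 11 (by norm_num) (by norm_num) h
  · exact key 13 (by norm_num) (by norm_num) h

theorem mainTheorem2 (r : ℕ) (s t : ℤ) (ℓ : ℕ) (hℓ : ℓ.Prime)
    (hΘ : CongrMod ℓ
      (ramanujanTheta (eisensteinQ 2 ^ r * eisensteinQ 4 ^ s * eisensteinQ 6 ^ t)) 0) :
    ℓ ≤ 13 ∨ ((r : ℤ) ≡ 0 [ZMOD ℓ] ∧ s ≡ 0 [ZMOD ℓ] ∧ t ≡ 0 [ZMOD ℓ]) := by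
  set u : (PowerSeries ℤ)ˣ := sigmaUnit (-24) 1 ^ r * sigmaUnit 240 3 ^ s * sigmaUnit (-504) 5 ^ t
    with hu
  have hf : eisensteinQ 2 ^ r * eisensteinQ 4 ^ s * eisensteinQ 6 ^ t = intSeriesToLaurent u := by
    have hz (v : (PowerSeries ℤ)ˣ) (n : ℤ) := map_units_zpow intSeriesToLaurent.toMonoidHom v n
    simp only [RingHom.toMonoidHom_eq_coe, MonoidHom.coe_coe] at hz
    rw [hu, Units.val_mul, Units.val_mul, map_mul, map_mul, hz, hz, Units.val_pow_eq_pow_val,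
      map_pow, eisensteinQ_two, eisensteinQ_four, eisensteinQ_six]
  rw [hf] at hΘ
  have hL : (unitLogDeriv u).toAdd = (r : ℤ) • (unitLogDeriv (sigmaUnit (-24) 1)).toAdd
      + s • (unitLogDeriv (sigmaUnit 240 3)).toAdd
      + t • (unitLogDeriv (sigmaUnit (-504) 5)).toAdd := by
    simp [hu]
  have hd := dvd_coeff_unitLogDeriv hℓ u hΘ
  rw [hL] at hd
  obtain ⟨p0, p1, p2⟩ := coeff_unitLogDeriv_sigmaUnit (-24) 1 (s₂ := 3) (s₃ := 4)
    (by decide) (by decide)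
  obtain ⟨q0, q1, q2⟩ := coeff_unitLogDeriv_sigmaUnit 240 3 (s₂ := 9) (s₃ := 28)
    (by decide) (by decide)
  obtain ⟨r0, r1, r2⟩ := coeff_unitLogDeriv_sigmaUnit (-504) 5 (s₂ := 33) (s₃ := 244)
    (by decide) (by decide)
  obtain ⟨k₀, d0⟩ := hd 0
  obtain ⟨k₁, d1⟩ := hd 1
  obtain ⟨k₂, d2⟩ := hd 2
  simp only [map_add, map_zsmul, p0, p1, p2, q0, q1, q2, r0, r1, r2, smul_eq_mul] at d0 d1 d2
  -- Cramer's rule: the constant is minus the determinant of the system `d0, d1, d2`, and the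
  -- multipliers here and in `hs`, `ht` are the rows of minus its adjugate.
  have hr : (ℓ : ℤ) ∣ 2 ^ 18 * 3 ^ 8 * 5 ^ 2 * 7 ^ 2 * 11 * 13 * (r : ℤ) :=
    ⟨-11711014318080 * k₀ - 30656102400 * k₁ + 95800320 * k₂,
      by linear_combination -11711014318080 * d0 - 30656102400 * d1 + 95800320 * d2⟩
  have hs : (ℓ : ℤ) ∣ 2 ^ 18 * 3 ^ 8 * 5 ^ 2 * 7 ^ 2 * 11 * 13 * s :=
    ⟨105005859840 * k₀ - 3675248640 * k₁ + 6531840 * k₂,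
      by linear_combination 105005859840 * d0 - 3675248640 * d1 + 6531840 * d2⟩
  have ht : (ℓ : ℤ) ∣ 2 ^ 18 * 3 ^ 8 * 5 ^ 2 * 7 ^ 2 * 11 * 13 * t :=
    ⟨9876142080 * k₀ - 290304000 * k₁ - 1451520 * k₂,
      by linear_combination 9876142080 * d0 - 290304000 * d1 - 1451520 * d2⟩
  refine or_iff_not_imp_left.mpr fun h13 => ?_
  have hcancel {x : ℤ} (hx : (ℓ : ℤ) ∣ 2 ^ 18 * 3 ^ 8 * 5 ^ 2 * 7 ^ 2 * 11 * 13 * x) :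
      x ≡ 0 [ZMOD ℓ] :=
    Int.modEq_zero_iff_dvd.mpr <| ((Nat.prime_iff_prime_int.mp hℓ).dvd_or_dvd hx).resolve_left
      fun h => h13 (le_thirteen_of_dvd hℓ h)
  exact ⟨hcancel hr, hcancel hs, hcancel ht⟩
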